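/- Let $n \ge 0$ and let $H=\{w_1,\dots,w_T\}$ be a finite set of $T$ distinct non-zero vectors spanning $\mathbb{R}^{n+1}$. Let $K^H$ be the simplicial complex on $H$ whose simplices are the subsets $S\subseteq H$ with $\operatorname{span}(S)\neq\mathbb{R}^{n+1}$. Let $H^{\times n}_{\neq 0}$ be the set of ordered linearly independent $n$-tuples $W=(w_{i_1},\dots,w_{i_n})$ of vectors of $H$. For such $W$ and $0\le l\le n$ put $L_l(W)=\operatorname{span}(w_{i_{n-l+1}},\dots,w_{i_n})$ (the span of the last $l$ vectors of $W$), $q_l^W=|L_l(W)\cap H|$, and $W[H]=q_n^W q_{n-1}^W\cdots q_1^W$. Then for every field $\mathbb{F}$ and all real weights $p_1,\dots,p_T$ with $\sum_{i=1}^T p_i=1$ (in particular, for every probability distribution $p$ on $H$), $$\operatorname{rank}\,\tilde H_{n-1}(K^H;\mathbb{F})=\sum_{W\in H^{\times n}_{\neq 0}}\frac{1-\sum_{i:\,w_i\in L_n(W)}p_i}{W[H]},$$ where $\tilde H_{n-1}$ denotes reduced simplicial homology, with the empty simplex in dimension $-1$ (for $n\ge 2$ it coincides with the ordinary homology $H_{n-1}$).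 -/

import Mathlib

namespace SimplicialHomology

noncomputable section

variable {ι : Type*} [Fintype ι] [LinearOrder ι] (F : Type*) [Field F]

/-- The simplicial boundary operator on the vector space `Finset ι → F`, whose standard basis
`[s] = Pi.single s 1` is indexed by the subsets `s` of a finite linearly ordered vertex set:
`∂ [v₀ < ⋯ < v_d] = ∑ j, (-1) ^ j [v₀, …, v̂_j, …, v_d]`.
The exponent `j` is the number of vertices of the simplex that precede the deleted vertex.
For a single vertex this is the augmentation `∂ [v] = [∅]`, and `∂ [∅] = 0`. -/
def boundary : (Finset ι → F) →ₗ[F] (Finset ι → F) :=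
  Fintype.linearCombination F fun s : Finset ι =>
    ∑ v ∈ s, (-1 : F) ^ (s.filter (· < v)).card • Pi.single (s.erase v) (1 : F)

theorem boundary_single (s : Finset ι) :
    boundary F (Pi.single s 1) =
      ∑ v ∈ s, (-1 : F) ^ (s.filter (· < v)).card • Pi.single (s.erase v) (1 : F) := by
  rw [boundary, Fintype.linearCombination_apply_single, one_smul]

/-- The simplices of dimension `i` in the augmented complex: the faces with `i + 1` vertices, the
empty set being the only simplex of dimension `-1`. -/
def simplices (K : PreAbstractSimplicialComplex ι) (i : ℤ) : Set (Finset ι) :=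
  {s | (s = ∅ ∨ s ∈ K.faces) ∧ (s.card : ℤ) = i + 1}

/-- The augmented simplicial chains of dimension `i` with coefficients in `F`: the functions on
subsets that vanish off the `i`-dimensional simplices. -/
def chains (K : PreAbstractSimplicialComplex ι) (i : ℤ) : Submodule F (Finset ι → F) where
  carrier := {c | ∀ s, s ∉ simplices K i → c s = 0}
  zero_mem' := fun _ _ => rfl
  add_mem' := fun ha hb s hs => by simp [ha s hs, hb s hs]
  smul_mem' := fun r a ha s hs => by simp [ha s hs]

/-- The (augmented) cycles of dimension `i`. -/
def cycles (K : PreAbstractSimplicialComplex ι) (i : ℤ) : Submodule F (Finset ι → F) :=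
  chains F K i ⊓ LinearMap.ker (boundary F)

/-- The boundaries of dimension `i`. -/
def boundaries (K : PreAbstractSimplicialComplex ι) (i : ℤ) : Submodule F (Finset ι → F) :=
  (chains F K (i + 1)).map (boundary F)

/-- Reduced simplicial homology `H̃_i(K; F)`: cycles modulo boundaries of the augmented complex.
In dimensions `i ≥ 1` it is the same as the unreduced homology. -/
abbrev ReducedHomology (K : PreAbstractSimplicialComplex ι) (i : ℤ) : Type _ :=
  cycles F K i ⧸ (boundaries F K i).submoduleOf (cycles F K i)

theorem boundary_boundary (c : Finset ι → F) : boundary F (boundary F c) = 0 := by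
  suffices h : (boundary F : (Finset ι → F) →ₗ[F] _) ∘ₗ boundary F = 0 from
    LinearMap.congr_fun h c
  refine (Pi.basisFun F (Finset ι)).ext fun s => ?_
  · rw [Pi.basisFun_apply, LinearMap.comp_apply, LinearMap.zero_apply, boundary_single, map_sum]
    simp only [map_smul, boundary_single, Finset.smul_sum, smul_smul]
    rw [Finset.sum_sigma']
    refine Finset.sum_involution (fun x _ => ⟨x.2, x.1⟩) ?_ ?_ ?_ ?_
    · rintro ⟨v, u⟩ h
      simp only [Finset.mem_sigma, Finset.mem_erase] at h
      obtain ⟨hv, huv, hu⟩ := h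
      have key : ∀ x y : ι, x ∈ s → y ∈ s → x < y →
          ((s.erase y).filter (· < x)).card = (s.filter (· < x)).card ∧
          ((s.erase x).filter (· < y)).card + 1 = (s.filter (· < y)).card := by
        intro x y hx hy hxy
        constructor
        · rw [Finset.filter_erase, Finset.erase_eq_of_notMem]
          simp [hxy.le]
        · rw [Finset.filter_erase, Finset.card_erase_add_one]
          simp [hx, hxy]
      rw [Finset.erase_right_comm, ← add_smul]
      convert zero_smul F _
      rcases lt_or_gt_of_ne huv with h | h
      · obtain ⟨h1, h2⟩ := key u v hu hv h
        rw [h1, ← h2]; ring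
      · obtain ⟨h1, h2⟩ := key v u hv hu h
        rw [h1, ← h2]; ring
    · rintro ⟨v, u⟩ h _ heq
      simp only [Finset.mem_sigma, Finset.mem_erase] at h
      simp only [Sigma.mk.injEq] at heq
      exact h.2.1 heq.1
    · rintro ⟨v, u⟩ h
      simp only [Finset.mem_sigma, Finset.mem_erase] at h ⊢
      exact ⟨h.2.2, h.2.1.symm, h.1⟩
    · rintro ⟨v, u⟩ h
      rfl

theorem boundaries_le_cycles (K : PreAbstractSimplicialComplex ι) (i : ℤ) :
    boundaries F K i ≤ cycles F K i := by
  rintro _ ⟨c, hc, rfl⟩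
  refine ⟨fun t ht => ?_, boundary_boundary F c⟩
  rw [boundary, Fintype.linearCombination_apply, Finset.sum_apply]
  refine Finset.sum_eq_zero fun s _ => ?_
  by_cases hs : s ∈ simplices K (i + 1)
  · rw [Pi.smul_apply, Finset.sum_apply, Finset.sum_eq_zero, smul_zero]
    intro v hv
    rw [Pi.smul_apply, Pi.single_eq_of_ne, smul_zero]
    rintro rfl
    obtain ⟨hK, hcard⟩ := hs
    have hface : s ∈ K.faces := hK.resolve_left (Finset.ne_empty_of_mem hv)
    refine ht ⟨?_, ?_⟩
    · rcases Finset.eq_empty_or_nonempty (s.erase v) with h | h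
      · exact Or.inl h
      · exact Or.inr ((K.isRelLowerSet_faces hface).2 (Finset.erase_subset v s) h)
    · have := Finset.card_erase_add_one hv
      lia
  · rw [hc s hs, zero_smul, Pi.zero_apply]

end

end SimplicialHomology

namespace VectorConfiguration

noncomputable section

variable {ι V : Type*} [AddCommGroup V] [Module ℝ V]

/-- The complex `K^H` of a family `H = (w_i)` of vectors: a nonempty finite set of indices is a
simplex iff the corresponding vectors do not span the whole space. -/
def nonspanningComplex (w : ι → V) : PreAbstractSimplicialComplex ι where
  faces := {s | s.Nonempty ∧ Submodule.span ℝ (w '' (s : Set ι)) ≠ ⊤}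
  isRelLowerSet_faces := by
    rintro s ⟨hs, hspan⟩
    refine ⟨hs, fun t hts ht => ⟨ht, fun h => hspan ?_⟩⟩
    exact top_le_iff.mp (h ▸ Submodule.span_mono (Set.image_mono (by exact_mod_cast hts)))

/-- `L_l(W)`, the span of the last `l` vectors of the tuple `W = (w_{i_1}, …, w_{i_n})`.
The positions `j : Fin n` are counted from `0`, so the last `l` of them are those with
`n ≤ j + l`. -/
def flagSpace (w : ι → V) {n : ℕ} (W : Fin n → ι) (l : ℕ) : Submodule ℝ V :=
  Submodule.span ℝ ((fun j => w (W j)) '' {j : Fin n | n ≤ (j : ℕ) + l})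

variable [Fintype ι]

open Classical in
/-- The (indices of the) vectors of `H` that lie in `L_l(W)`. -/
def flagMembers (w : ι → V) {n : ℕ} (W : Fin n → ι) (l : ℕ) : Finset ι :=
  Finset.univ.filter fun i => w i ∈ flagSpace w W l

/-- `W[H] = q_n^W ⋯ q_1^W`, where `q_l^W` is the number of vectors of `H` in `L_l(W)`. -/
def flagProduct (w : ι → V) {n : ℕ} (W : Fin n → ι) : ℕ :=
  ∏ l ∈ Finset.Icc 1 n, (flagMembers w W l).card

open Classical in
/-- The ordered linearly independent `n`-tuples of vectors of `H` (given by their indices). -/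
def independentTuples (w : ι → V) (n : ℕ) : Finset (Fin n → ι) :=
  Finset.univ.filter fun W => LinearIndependent ℝ fun j => w (W j)

end

end VectorConfiguration

/-! For a flat `L`, let `Z(L)` (`flatCocycles`) be the cochains supported on bases of `L` taken from
`H` that are cocycles on the full simplex with vertex set `L ∩ H`. Everything rests on one cone
homotopy: contraction `ι_a` with a vertex `a` satisfies `δ ι_a + ι_a δ = id`. Since that simplex is
acyclic, `f ↦ ⟨ι_a f, ·⟩` identifies `Z(⊤)` with the dual of the homology of `K^H` in dimension `n -
1`. For `w a ∈ L`, the homotopy also makes `δ` an isomorphism from the direct sum of the `Z(L')`,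
over the hyperplane flats `L'` of `L` avoiding `w a`, onto `Z(L)`. Hence `dim Z(L) = ∑ dim Z(L')`
for every choice of `a` (`finrank_flatCocycles`). Averaging this recursion uniformly over `a ∈ L ∩
H` produces a factor `1 / q` at each rank, so `dim Z(L)` is the sum of `1 / W[H]` over ordered bases
`W` of `L`. At the top flat the average over `a` is taken with the weights `p` instead; a tuple `W`
is counted for exactly those `a` outside `L_n(W)`, which gives the numerator. -/

namespace SimplicialHomology

noncomputable section

/-! ### Cochains on the full simplex and the cone homotopy. -/

variable {ι : Type*} [LinearOrder ι] (F : Type*) [Field F]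

/-- The simplicial coboundary operator, the transpose of `boundary`. -/
def coboundary : (Finset ι → F) →ₗ[F] (Finset ι → F) where
  toFun f s := ∑ v ∈ s, (-1 : F) ^ (s.filter (· < v)).card * f (s.erase v)
  map_add' f g := by
    ext s
    simp [mul_add, Finset.sum_add_distrib]
  map_smul' r f := by
    ext s
    simp only [Pi.smul_apply, smul_eq_mul, RingHom.id_apply, Finset.mul_sum]
    exact Finset.sum_congr rfl fun v _ => by ring

theorem coboundary_apply (f : Finset ι → F) (s : Finset ι) :
    coboundary F f s = ∑ v ∈ s, (-1 : F) ^ (s.filter (· < v)).card * f (s.erase v) := rfl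

/-- Contraction of cochains with a vertex `a`, the transpose of the cone operator with apex `a`. -/
def contraction (a : ι) : (Finset ι → F) →ₗ[F] (Finset ι → F) where
  toFun f s := if a ∈ s then 0 else (-1 : F) ^ (s.filter (· < a)).card * f (insert a s)
  map_add' f g := by
    ext s
    by_cases h : a ∈ s <;> simp [h, mul_add]
  map_smul' r f := by
    ext s
    by_cases h : a ∈ s
    · simp [h]
    · simp only [h, if_false, Pi.smul_apply, smul_eq_mul, RingHom.id_apply]
      ring

variable {F}

theorem contraction_of_mem {a : ι} {s : Finset ι} (h : a ∈ s) (f : Finset ι → F) :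
    contraction F a f s = 0 := if_pos h

theorem contraction_of_notMem {a : ι} {s : Finset ι} (h : a ∉ s) (f : Finset ι → F) :
    contraction F a f s = (-1 : F) ^ (s.filter (· < a)).card * f (insert a s) := if_neg h

/-- If `a ∈ s`, only the deletion of `a` contributes. If `a ∉ s`, deleting `a` from `insert a s`
returns `f s`, and the deletions of `v ≠ a` cancel between the two terms, because inserting `a` and
deleting `v` anticommute. -/
theorem coboundary_contraction_add (a : ι) (f : Finset ι → F) (s : Finset ι) :
    coboundary F (contraction F a f) s + contraction F a (coboundary F f) s = f s := by
  have sq : ∀ k : ℕ, (-1 : F) ^ k * (-1 : F) ^ k = 1 := fun k => by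
    rw [← mul_pow]; simp
  by_cases h : a ∈ s
  · rw [contraction_of_mem h, add_zero, coboundary_apply, Finset.sum_eq_single_of_mem a h]
    · rw [contraction_of_notMem (Finset.notMem_erase a s), Finset.insert_erase h,
        Finset.filter_erase, Finset.erase_eq_of_notMem (by simp), ← mul_assoc, sq, one_mul]
    · intro v _ hva
      rw [contraction_of_mem (Finset.mem_erase.mpr ⟨hva.symm, h⟩), mul_zero]
  · rw [contraction_of_notMem h, coboundary_apply, coboundary_apply, Finset.sum_insert h,
      mul_add, Finset.erase_insert h, Finset.filter_insert, if_neg (lt_irrefl a), ← mul_assoc, sq,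
      one_mul, add_left_comm, Finset.mul_sum, ← Finset.sum_add_distrib, add_eq_left]
    refine Finset.sum_eq_zero fun v hv => ?_
    have hva : v ≠ a := fun e => h (e ▸ hv)
    rw [contraction_of_notMem (fun h' => h (Finset.mem_of_mem_erase h')),
      Finset.erase_insert_of_ne hva.symm, ← mul_assoc, ← mul_assoc, ← add_mul, Finset.filter_insert,
      Finset.filter_erase]
    convert zero_mul _
    rcases lt_or_gt_of_ne hva with hlt | hlt
    · rw [if_neg hlt.not_gt, ← Finset.card_erase_add_one
        (Finset.mem_filter.mpr ⟨hv, hlt⟩ : v ∈ s.filter (· < a))]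
      ring
    · rw [if_pos hlt, Finset.card_insert_of_notMem (by simp [h]),
        Finset.erase_eq_of_notMem (by simp [hlt.le])]
      ring

variable [Fintype ι]

theorem dotProduct_boundary (f c : Finset ι → F) :
    f ⬝ᵥ boundary F c = coboundary F f ⬝ᵥ c := by
  have h : dotProductEquiv F (Finset ι) f ∘ₗ boundary F =
      dotProductEquiv F (Finset ι) (coboundary F f) := by
    refine (Pi.basisFun F (Finset ι)).ext fun s => ?_
    simp only [Pi.basisFun_apply, LinearMap.comp_apply, boundary_single, dotProductEquiv_apply_apply,
      dotProduct_single_one, coboundary_apply, map_sum, map_smul, smul_eq_mul]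
  exact LinearMap.congr_fun h c

theorem coboundary_eq_dotProduct (f : Finset ι → F) (s : Finset ι) :
    coboundary F f s = f ⬝ᵥ boundary F (Pi.single s 1) := by
  rw [dotProduct_boundary, dotProduct_single_one]

theorem coboundary_coboundary (f : Finset ι → F) : coboundary F (coboundary F f) = 0 := by
  ext s
  rw [coboundary_eq_dotProduct, ← dotProduct_boundary, boundary_boundary, dotProduct_zero,
    Pi.zero_apply]

end

end SimplicialHomology

/-! ### Cocycles on flats and their duality with homology. -/

namespace VectorConfiguration

open SimplicialHomology

noncomputable section

variable {ι V : Type*} [AddCommGroup V] [Module ℝ V]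

/-- The span of the vectors with indices in `s`. -/
abbrev faceSpan (w : ι → V) (s : Finset ι) : Submodule ℝ V := Submodule.span ℝ (w '' (s : Set ι))

variable {F : Type*} [Field F] {w : ι → V}

theorem faceSpan_le {L : Submodule ℝ V} {s : Finset ι} : faceSpan w s ≤ L ↔ ∀ i ∈ s, w i ∈ L := by
  simp [faceSpan, Submodule.span_le, Set.subset_def]

theorem faceSpan_mono {s t : Finset ι} (h : s ⊆ t) : faceSpan w s ≤ faceSpan w t :=
  Submodule.span_mono (Set.image_mono (by exact_mod_cast h))

theorem finrank_faceSpan_le (s : Finset ι) : Module.finrank ℝ (faceSpan w s) ≤ s.card := by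
  classical
  have h := finrank_span_finset_le_card (R := ℝ) (s.image w)
  rw [Set.finrank, Finset.coe_image] at h
  exact h.trans Finset.card_image_le

theorem card_eq_of_mem_chains {n : ℕ} {K : PreAbstractSimplicialComplex ι} {c : Finset ι → F}
    (hc : c ∈ chains F K ((n : ℤ) - 1)) {s : Finset ι} (hs : c s ≠ 0) : s.card = n := by
  by_contra h
  exact hs (hc s fun hs' => h (by have := hs'.2; omega))

/-- Fewer than `n + 1` vectors never span, so `K^H` contains every set of `n` vertices. -/
theorem mem_chains_of_forall_card {n : ℕ} (hV : Module.finrank ℝ V = n + 1) {c : Finset ι → F}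
    (hc : ∀ s, s.card ≠ n → c s = 0) : c ∈ chains F (nonspanningComplex w) ((n : ℤ) - 1) := by
  intro s hs
  refine hc s fun hcard => hs ⟨?_, by rw [hcard]; ring⟩
  refine s.eq_empty_or_nonempty.imp_right fun hne => ⟨hne, fun htop => ?_⟩
  have := finrank_faceSpan_le (w := w) s
  rw [faceSpan, htop, finrank_top] at this
  omega

variable [LinearOrder ι]

theorem faceSpan_insert (a : ι) (s : Finset ι) :
    faceSpan w (insert a s) = Submodule.span ℝ {w a} ⊔ faceSpan w s := by
  rw [faceSpan, Finset.coe_insert, Set.image_insert_eq, Submodule.span_insert]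

variable (F w) in
/-- The cochains supported on the bases of the flat `L` that are cocycles on the full simplex with
vertex set `L ∩ H`. -/
def flatCocycles (L : Submodule ℝ V) : Submodule F (Finset ι → F) where
  carrier := {f | (∀ s, f s ≠ 0 → s.card = Module.finrank ℝ L ∧ faceSpan w s = L) ∧
    ∀ s : Finset ι, faceSpan w s ≤ L → coboundary F f s = 0}
  zero_mem' := ⟨fun s h => (h rfl).elim, fun s _ => by simp⟩
  add_mem' := fun {f g} hf hg => ⟨fun s h => by
      by_cases hfs : f s = 0
      · exact hg.1 s fun hgs => h (by simp [hfs, hgs])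
      · exact hf.1 s hfs,
    fun s hs => by simp [hf.2 s hs, hg.2 s hs]⟩
  smul_mem' := fun r f hf => ⟨fun s h => hf.1 s fun hfs => h (by simp [hfs]),
    fun s hs => by simp [hf.2 s hs]⟩

variable [Fintype ι]

theorem boundary_single_apply_of_card_ne (s t : Finset ι) (h : s.card ≠ t.card + 1) :
    boundary F (Pi.single s 1) t = 0 := by
  rw [boundary_single, Finset.sum_apply]
  refine Finset.sum_eq_zero fun v hv => ?_
  rw [Pi.smul_apply, Pi.single_eq_of_ne, smul_zero]
  rintro rfl
  exact h (Finset.card_erase_add_one hv).symm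

/-- Contracting a cocycle with a vertex gives a functional on homology. -/
def cocyclePairing (a : ι) {n : ℕ} (hV : Module.finrank ℝ V = n + 1) :
    flatCocycles F w (⊤ : Submodule ℝ V) →ₗ[F]
      Module.Dual F (ReducedHomology F (nonspanningComplex w) ((n : ℤ) - 1)) where
  toFun f := Submodule.liftQ _
    (dotProductEquiv F (Finset ι) (contraction F a f) ∘ₗ Submodule.subtype _) <| by
      rintro ⟨_, hz⟩ ⟨c, hc, rfl⟩
      rw [LinearMap.mem_ker, LinearMap.comp_apply, Submodule.subtype_apply,
        dotProductEquiv_apply_apply]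
      change contraction F a f.1 ⬝ᵥ boundary F c = 0
      rw [dotProduct_boundary]
      refine Finset.sum_eq_zero fun s _ => ?_
      have hco : coboundary F f.1 = 0 := funext fun s => f.2.2 s le_top
      have hf := coboundary_contraction_add a f.1 s
      rw [hco, map_zero, Pi.zero_apply, add_zero] at hf
      rw [hf]
      -- Here `δ ι_a f = f`. It pairs to zero with `c` because `f` lives on spanning sets and `c` on
      -- nonspanning ones.
      by_cases hfs : f.1 s = 0
      · rw [hfs, zero_mul]
      · obtain ⟨hcard, htop⟩ := f.2.1 s hfs
        rw [finrank_top, hV] at hcard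
        rw [hc s, mul_zero]
        rintro ⟨h | h, -⟩
        · simp [h] at hcard
        · exact h.2 htop
  map_add' f g := by
    refine Submodule.linearMap_qext _ (LinearMap.ext fun c => ?_)
    simp
  map_smul' r f := by
    refine Submodule.linearMap_qext _ (LinearMap.ext fun c => ?_)
    simp

theorem cocyclePairing_mk (a : ι) {n : ℕ} (hV : Module.finrank ℝ V = n + 1)
    (f : flatCocycles F w (⊤ : Submodule ℝ V))
    (c : cycles F (nonspanningComplex w) ((n : ℤ) - 1)) :
    cocyclePairing a hV f (Submodule.Quotient.mk c) = contraction F a f.1 ⬝ᵥ c.1 := rfl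

/-- The boundary of a full simplex `s` on `n + 1` vertices is a cycle of `K^H`, and pairing it with
`ι_a f` gives `(δ ι_a f) s = f s`. -/
theorem cocyclePairing_injective (a : ι) {n : ℕ} (hV : Module.finrank ℝ V = n + 1) :
    Function.Injective (cocyclePairing (F := F) (w := w) a hV) := by
  rw [← LinearMap.ker_eq_bot, LinearMap.ker_eq_bot']
  intro f hf
  ext s
  by_contra hfs
  obtain ⟨hcard, -⟩ := f.2.1 s hfs
  rw [finrank_top, hV] at hcard
  have hc : boundary F (Pi.single s 1) ∈ cycles F (nonspanningComplex w) ((n : ℤ) - 1) := by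
    refine ⟨mem_chains_of_forall_card hV fun t ht => ?_, boundary_boundary F _⟩
    exact boundary_single_apply_of_card_ne s t (by omega)
  have h := LinearMap.congr_fun hf (Submodule.Quotient.mk ⟨_, hc⟩)
  rw [cocyclePairing_mk, LinearMap.zero_apply, ← coboundary_eq_dotProduct] at h
  have hco : coboundary F f.1 = 0 := funext fun s => f.2.2 s le_top
  have h' := coboundary_contraction_add a f.1 s
  rw [hco, map_zero, Pi.zero_apply, add_zero, h] at h'
  exact hfs h'.symm

/-- A functional on homology lifts to a cochain `g`. Its coboundary is the required cocycle: it
vanishes on nonspanning sets because the functional kills boundaries, and `ι_a δ g` differs from `g`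
by a coboundary, invisible on cycles. -/
theorem cocyclePairing_surjective (a : ι) {n : ℕ} (hV : Module.finrank ℝ V = n + 1) :
    Function.Surjective (cocyclePairing (F := F) (w := w) a hV) := by
  intro φ
  obtain ⟨ψ, hψ⟩ := LinearMap.exists_extend (φ ∘ₗ Submodule.mkQ _)
  set g₀ := (dotProductEquiv F (Finset ι)).symm ψ with hg₀
  have hg₀ψ : ∀ c, g₀ ⬝ᵥ c = ψ c := fun c => by
    rw [← dotProductEquiv_apply_apply, hg₀, LinearEquiv.apply_symm_apply]
  -- Cutting `g₀` down to sets of size `n` does not change its values on cycles, and confines `δ g`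
  -- to sets of size `n + 1`.
  set g : Finset ι → F := fun s => if s.card = n then g₀ s else 0 with hg
  have hgφ : ∀ c : cycles F (nonspanningComplex w) ((n : ℤ) - 1),
      g ⬝ᵥ c.1 = φ (Submodule.Quotient.mk c) := by
    intro c
    have h1 : g ⬝ᵥ c.1 = g₀ ⬝ᵥ c.1 := by
      refine Finset.sum_congr rfl fun s _ => ?_
      by_cases hs : c.1 s = 0
      · rw [hs, mul_zero, mul_zero]
      · rw [hg]; simp only [card_eq_of_mem_chains c.2.1 hs, if_true]
    rw [h1, hg₀ψ]
    exact LinearMap.congr_fun hψ c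
  have hf : coboundary F g ∈ flatCocycles F w (⊤ : Submodule ℝ V) := by
    refine ⟨fun s hs => ?_, fun s _ => by rw [coboundary_coboundary]; rfl⟩
    have hcard : s.card = n + 1 := by
      by_contra hne
      refine hs (Finset.sum_eq_zero fun v hv => ?_)
      have := Finset.card_erase_add_one hv
      rw [hg]
      simp only
      rw [if_neg (by omega), mul_zero]
    refine ⟨by rw [finrank_top, hV, hcard], ?_⟩
    by_contra htop
    apply hs
    have hb : boundary F (Pi.single s 1) ∈ boundaries F (nonspanningComplex w) ((n : ℤ) - 1) := by
      refine ⟨Pi.single s 1, fun t ht => Pi.single_eq_of_ne ?_ _, rfl⟩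
      rintro rfl
      exact ht ⟨Or.inr ⟨Finset.card_pos.mp (by omega), htop⟩, by rw [hcard]; push_cast; ring⟩
    have h := hgφ ⟨_, boundaries_le_cycles F _ _ hb⟩
    rw [coboundary_eq_dotProduct, h]
    convert map_zero φ
    exact (Submodule.Quotient.mk_eq_zero _).mpr hb
  refine ⟨⟨_, hf⟩, Submodule.linearMap_qext _ (LinearMap.ext fun c => ?_)⟩
  rw [LinearMap.comp_apply, LinearMap.comp_apply, Submodule.mkQ_apply, cocyclePairing_mk, ← hgφ c]
  have h : contraction F a (coboundary F g) = g - coboundary F (contraction F a g) :=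
    funext fun s => eq_sub_of_add_eq' (coboundary_contraction_add a g s)
  rw [h, sub_dotProduct, ← dotProduct_boundary, LinearMap.mem_ker.mp c.2.2, dotProduct_zero,
    sub_zero]

theorem finrank_reducedHomology (a : ι) {n : ℕ} (hV : Module.finrank ℝ V = n + 1) :
    Module.finrank F (ReducedHomology F (nonspanningComplex w) ((n : ℤ) - 1)) =
      Module.finrank F (flatCocycles F w (⊤ : Submodule ℝ V)) := by
  rw [← Subspace.dual_finrank_eq]
  exact (LinearEquiv.ofBijective (cocyclePairing a hV)
    ⟨cocyclePairing_injective a hV, cocyclePairing_surjective a hV⟩).finrank_eq.symm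

end

end VectorConfiguration

/-! ### The recursion from a flat to its hyperplanes. -/

namespace VectorConfiguration

open SimplicialHomology

noncomputable section

variable {ι V : Type*} [AddCommGroup V] [Module ℝ V] {F : Type*} [Field F] {w : ι → V}

theorem flagSpace_self {n : ℕ} (W : Fin n → ι) :
    flagSpace w W n = Submodule.span ℝ (Set.range fun j => w (W j)) := by
  rw [flagSpace, ← Set.image_univ]
  congr 2
  ext j
  simp

variable [Fintype ι]

theorem mem_independentTuples {n : ℕ} {W : Fin n → ι} :
    W ∈ independentTuples w n ↔ LinearIndependent ℝ fun j => w (W j) := by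
  simp [independentTuples]

theorem finrank_flagSpace_self {n : ℕ} {W : Fin n → ι} (hW : W ∈ independentTuples w n) :
    Module.finrank ℝ (flagSpace w W n) = n := by
  rw [flagSpace_self, finrank_span_eq_card (mem_independentTuples.mp hW), Fintype.card_fin]

open Classical in
variable (w) in
/-- The flats of rank `d`: the subspaces spanned by `d` linearly independent vectors of `H`. -/
def flats (d : ℕ) : Finset (Submodule ℝ V) :=
  (independentTuples w d).image fun W => flagSpace w W d

theorem mem_flats {d : ℕ} {L : Submodule ℝ V} :
    L ∈ flats w d ↔ ∃ W ∈ independentTuples w d, flagSpace w W d = L := by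
  simp [flats]

theorem finrank_of_mem_flats {d : ℕ} {L : Submodule ℝ V} (hL : L ∈ flats w d) :
    Module.finrank ℝ L = d := by
  obtain ⟨W, hW, rfl⟩ := mem_flats.mp hL
  exact finrank_flagSpace_self hW

variable [LinearOrder ι]

theorem faceSpan_mem_flats {d : ℕ} {s : Finset ι} (hs : s.card = d)
    (hd : Module.finrank ℝ (faceSpan w s) = d) : faceSpan w s ∈ flats w d := by
  have hr : (Set.range fun j => w (s.orderEmbOfFin hs j)) = w '' (s : Set ι) := by
    rw [← s.range_orderEmbOfFin hs, ← Set.range_comp]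
    rfl
  refine mem_flats.mpr ⟨s.orderEmbOfFin hs, mem_independentTuples.mpr ?_, ?_⟩
  · rw [linearIndependent_iff_card_eq_finrank_span, Set.finrank, hr, Fintype.card_fin]
    exact hd.symm
  · rw [flagSpace_self, hr]

-- Removing `a` from a basis of `L` leaves a basis of a hyperplane of `L` avoiding `w a`; hence `ι_a
-- f` decomposes over `flatsAvoiding`.
omit [Fintype ι] in
theorem contraction_support {L : Submodule ℝ V} {d : ℕ} (hd : Module.finrank ℝ L = d + 1) {a : ι}
    {f : Finset ι → F} (hf : f ∈ flatCocycles F w L) {s : Finset ι}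
    (hs : contraction F a f s ≠ 0) :
    s.card = d ∧ Module.finrank ℝ (faceSpan w s) = d ∧ faceSpan w s ≤ L ∧
      w a ∉ faceSpan w s := by
  have has : a ∉ s := fun h => hs (contraction_of_mem h f)
  rw [contraction_of_notMem has] at hs
  obtain ⟨hcard, hspan⟩ := hf.1 _ (right_ne_zero_of_mul hs)
  rw [Finset.card_insert_of_notMem has, hd] at hcard
  have hcard : s.card = d := by omega
  have hle := finrank_faceSpan_le (w := w) s
  have hfin : FiniteDimensional ℝ (faceSpan w s) :=
    FiniteDimensional.span_of_finite ℝ (s.finite_toSet.image w)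
  have hadd := Submodule.finrank_add_le_finrank_add_finrank (Submodule.span ℝ {w a}) (faceSpan w s)
  have h1 : Module.finrank ℝ (Submodule.span ℝ {w a}) ≤ 1 := (finrank_span_le_card {w a}).trans (by simp)
  rw [← faceSpan_insert, hspan, hd] at hadd
  refine ⟨hcard, by omega, hspan ▸ faceSpan_mono (Finset.subset_insert a s), fun ha => ?_⟩
  rw [faceSpan_insert, sup_eq_right.mpr ((Submodule.span_singleton_le_iff_mem _ _).mpr ha)] at hspan
  rw [hspan] at hle
  omega

variable (F w) in
/-- The sum of a family of cochains on distinct flats. -/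
def totalCochain (A : Finset (Submodule ℝ V)) :
    (∀ L : A, flatCocycles F w L.1) →ₗ[F] (Finset ι → F) :=
  ∑ L : A, (flatCocycles F w L.1).subtype ∘ₗ LinearMap.proj L

omit [Fintype ι] in
theorem totalCochain_apply {A : Finset (Submodule ℝ V)} (g : ∀ L : A, flatCocycles F w L.1)
    (s : Finset ι) : totalCochain F w A g s = ∑ L : A, (g L).1 s := by
  simp [totalCochain]

omit [Fintype ι] in
theorem totalCochain_apply_of_eq {A : Finset (Submodule ℝ V)} (g : ∀ L : A, flatCocycles F w L.1)
    {s : Finset ι} (L : A) (hs : faceSpan w s = L) : totalCochain F w A g s = (g L).1 s := by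
  rw [totalCochain_apply, Finset.sum_eq_single_of_mem L (Finset.mem_univ L)]
  intro L' _ hne
  by_contra h
  exact hne (Subtype.ext (((g L').2.1 s h).2.symm.trans hs))

omit [Fintype ι] in
theorem totalCochain_support {A : Finset (Submodule ℝ V)} {g : ∀ L : A, flatCocycles F w L.1}
    {s : Finset ι} (hs : totalCochain F w A g s ≠ 0) :
    faceSpan w s ∈ A ∧ s.card = Module.finrank ℝ (faceSpan w s) := by
  rw [totalCochain_apply] at hs
  obtain ⟨L, -, hL⟩ := Finset.exists_ne_zero_of_sum_ne_zero hs
  obtain ⟨h1, h2⟩ := (g L).2.1 s hL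
  rw [h2]
  exact ⟨L.2, h1⟩

open Classical in
variable (F w) in
/-- Truncation of a cochain to the full simplex on `L ∩ H`. -/
def truncation (L : Submodule ℝ V) : (Finset ι → F) →ₗ[F] (Finset ι → F) where
  toFun f s := if faceSpan w s ≤ L then f s else 0
  map_add' f g := by
    ext s
    by_cases h : faceSpan w s ≤ L <;> simp [h]
  map_smul' r f := by
    ext s
    by_cases h : faceSpan w s ≤ L <;> simp [h]

omit [Fintype ι] [LinearOrder ι] in
theorem truncation_of_le {L : Submodule ℝ V} {s : Finset ι} (h : faceSpan w s ≤ L)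
    (f : Finset ι → F) : truncation F w L f s = f s := if_pos h

omit [Fintype ι] [LinearOrder ι] in
theorem truncation_of_not_le {L : Submodule ℝ V} {s : Finset ι} (h : ¬ faceSpan w s ≤ L)
    (f : Finset ι → F) : truncation F w L f s = 0 := if_neg h

omit [Fintype ι] in
theorem coboundary_truncation {L : Submodule ℝ V} {s : Finset ι} (h : faceSpan w s ≤ L)
    (f : Finset ι → F) : coboundary F (truncation F w L f) s = coboundary F f s :=
  Finset.sum_congr rfl fun v _ => by
    rw [truncation_of_le ((faceSpan_mono (Finset.erase_subset v s)).trans h)]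

open Classical in
variable (w) in
/-- The flats of rank `d` contained in `L` that avoid `w a`. -/
def flatsAvoiding (d : ℕ) (L : Submodule ℝ V) (a : ι) : Finset (Submodule ℝ V) :=
  (flats w d).filter fun L' => L' ≤ L ∧ w a ∉ L'

omit [LinearOrder ι] in
theorem mem_flatsAvoiding {d : ℕ} {L L' : Submodule ℝ V} {a : ι} :
    L' ∈ flatsAvoiding w d L a ↔ L' ∈ flats w d ∧ L' ≤ L ∧ w a ∉ L' := by
  simp [flatsAvoiding]

variable (F w) in
/-- The map gluing cocycles on the flats of rank `d` in `L` avoiding `w a`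
to a cocycle on `L`. -/
def glue (d : ℕ) (L : Submodule ℝ V) (a : ι) :
    (∀ L' : flatsAvoiding w d L a, flatCocycles F w L'.1) →ₗ[F] (Finset ι → F) :=
  truncation F w L ∘ₗ coboundary F ∘ₗ totalCochain F w (flatsAvoiding w d L a)

theorem glue_apply {d : ℕ} {L : Submodule ℝ V} {a : ι}
    (g : ∀ L' : flatsAvoiding w d L a, flatCocycles F w L'.1) :
    glue F w d L a g = truncation F w L (coboundary F (totalCochain F w _ g)) := rfl

/-- The point is the support. A set `s` with nonzero value has a facet spanning some flat `L'` of
the family. If `s` does not span `L`, it spans the same `L'`, and on all facets of `s` the total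
cochain agrees with its `L'`-component, a cocycle there. -/
theorem glue_mem [FiniteDimensional ℝ V] {d : ℕ} {L : Submodule ℝ V}
    (hd : Module.finrank ℝ L = d + 1) (a : ι)
    (g : ∀ L' : flatsAvoiding w d L a, flatCocycles F w L'.1) :
    glue F w d L a g ∈ flatCocycles F w L := by
  rw [glue_apply]
  refine ⟨fun s hs => ?_, fun s hs => by
    rw [coboundary_truncation hs, coboundary_coboundary, Pi.zero_apply]⟩
  have hsL : faceSpan w s ≤ L := by
    by_contra h
    exact hs (truncation_of_not_le h _)
  rw [truncation_of_le hsL] at hs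
  obtain ⟨v, hv, hne⟩ := Finset.exists_ne_zero_of_sum_ne_zero hs
  obtain ⟨hA, hcard⟩ := totalCochain_support (right_ne_zero_of_mul hne)
  have hrank := finrank_of_mem_flats (mem_flatsAvoiding.mp hA).1
  rw [hrank] at hcard
  have hcard' := Finset.card_erase_add_one hv
  refine ⟨by omega, ?_⟩
  by_contra hspan
  have hlt := Submodule.finrank_lt_finrank_of_lt (lt_of_le_of_ne hsL hspan)
  have heq : faceSpan w (s.erase v) = faceSpan w s :=
    Submodule.eq_of_le_of_finrank_le (faceSpan_mono (Finset.erase_subset v s)) (by omega)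
  refine hs (Eq.trans ?_ ((g ⟨_, hA⟩).2.2 s heq.ge))
  refine Finset.sum_congr rfl fun u hu => ?_
  congr 1
  -- A facet where the total cochain is nonzero has rank `d`, so it spans `L'` as well; a facet
  -- where it is zero cannot carry the `L'`-component alone.
  by_cases hu0 : totalCochain F w _ g (s.erase u) = 0
  · rw [totalCochain_apply] at hu0 ⊢
    by_cases hgu : (g ⟨_, hA⟩).1 (s.erase u) = 0
    · rw [hgu, hu0]
    · rw [← totalCochain_apply]
      exact totalCochain_apply_of_eq g _ ((g ⟨_, hA⟩).2.1 _ hgu).2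
  · refine totalCochain_apply_of_eq g _ ?_
    have hr := finrank_of_mem_flats (mem_flatsAvoiding.mp (totalCochain_support hu0).1).1
    change _ = faceSpan w (s.erase v)
    rw [heq]
    exact Submodule.eq_of_le_of_finrank_le (faceSpan_mono (Finset.erase_subset u s))
      (by rw [← heq]; omega)

/-- The total cochain `G` has no support on sets containing `a`, so `ι_a G = 0` and the homotopy
recovers `G` as `ι_a δ G`. -/
theorem glue_injective {d : ℕ} {L : Submodule ℝ V} {a : ι} (ha : w a ∈ L) :
    Function.Injective (glue F w d L a) := by
  rw [← LinearMap.ker_eq_bot, LinearMap.ker_eq_bot']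
  intro g hg
  rw [glue_apply] at hg
  funext L'
  ext s
  by_contra hs
  have hspan := ((g L').2.1 s hs).2
  obtain ⟨-, hle, haL'⟩ := mem_flatsAvoiding.mp L'.2
  have has : a ∉ s := fun h => haL' (hspan ▸ Submodule.subset_span ⟨a, h, rfl⟩)
  have hins : faceSpan w (insert a s) ≤ L := by
    rw [faceSpan_insert, sup_le_iff, hspan]
    exact ⟨(Submodule.span_singleton_le_iff_mem _ _).mpr ha, hle⟩
  set G := totalCochain F w _ g with hG
  have hcon : contraction F a G = 0 := by
    funext t
    by_cases hat : a ∈ t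
    · exact contraction_of_mem hat G
    · rw [contraction_of_notMem hat, Pi.zero_apply]
      by_contra h
      refine (mem_flatsAvoiding.mp (totalCochain_support (right_ne_zero_of_mul h)).1).2.2 ?_
      exact Submodule.subset_span ⟨a, Finset.mem_coe.mpr (Finset.mem_insert_self a t), rfl⟩
  have h0 := congr_fun hg (insert a s)
  rw [truncation_of_le hins, Pi.zero_apply] at h0
  have h := coboundary_contraction_add a G s
  rw [hcon, map_zero, contraction_of_notMem has, h0, mul_zero, Pi.zero_apply, add_zero, hG,
    totalCochain_apply_of_eq g L' hspan] at h
  exact hs h.symm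

/-- The preimage of `f` is `ι_a f`, split according to the span of each set. -/
theorem flatCocycles_le_range_glue [FiniteDimensional ℝ V] {d : ℕ} {L : Submodule ℝ V}
    (hd : Module.finrank ℝ L = d + 1) {a : ι} (ha : w a ∈ L) :
    flatCocycles F w L ≤ LinearMap.range (glue F w d L a) := by
  classical
  intro f hf
  have hhom : ∀ s : Finset ι, faceSpan w s ≤ L → coboundary F (contraction F a f) s = f s := by
    intro s hs
    rw [← coboundary_contraction_add a f s, left_eq_add]
    by_cases has : a ∈ s
    · exact contraction_of_mem has _
    · rw [contraction_of_notMem has, hf.2, mul_zero]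
      rw [faceSpan_insert, sup_le_iff]
      exact ⟨(Submodule.span_singleton_le_iff_mem _ _).mpr ha, hs⟩
  let g (L' : Submodule ℝ V) (s : Finset ι) : F :=
    if faceSpan w s = L' then contraction F a f s else 0
  have hg : ∀ L' ∈ flatsAvoiding w d L a, g L' ∈ flatCocycles F w L' := by
    intro L' hL'
    obtain ⟨hflat, hle, haL'⟩ := mem_flatsAvoiding.mp hL'
    have hrank := finrank_of_mem_flats hflat
    refine ⟨fun s hs => ?_, fun s hs => ?_⟩
    · obtain ⟨h1, h2⟩ := ne_eq _ _ ▸ ite_ne_right_iff.mp hs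
      exact ⟨by rw [hrank]; exact (contraction_support hd hf h2).1, h1⟩
    · have h1 : coboundary F (g L') s = coboundary F (contraction F a f) s := by
        refine Finset.sum_congr rfl fun v _ => ?_
        congr 1
        -- Inside `L'` nothing is lost by the split: a facet in the support of `ι_a f` has rank `d`,
        -- so it spans `L'`.
        refine ite_eq_left_iff.mpr fun hne => ?_
        by_contra h
        refine hne (Submodule.eq_of_le_of_finrank_le
          ((faceSpan_mono (Finset.erase_subset v s)).trans hs) ?_)
        rw [hrank, (contraction_support hd hf (Ne.symm h)).2.1]
      rw [h1, hhom s (hs.trans hle)]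
      -- A nonzero `f s` would force `s` to span `L`, putting `w a` into `L'`.
      by_contra h
      exact haL' (hs ((hf.1 s h).2 ▸ ha))
  refine ⟨fun L' => ⟨g L', hg L' L'.2⟩, ?_⟩
  have htotal : totalCochain F w (flatsAvoiding w d L a) (fun L' => ⟨g L', hg L' L'.2⟩) =
      contraction F a f := by
    funext s
    by_cases hs : faceSpan w s ∈ flatsAvoiding w d L a
    · rw [totalCochain_apply_of_eq _ ⟨_, hs⟩ rfl]
      exact if_pos rfl
    · rw [show contraction F a f s = 0 from ?_]
      · by_contra h
        exact hs (totalCochain_support h).1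
      · by_contra h
        obtain ⟨h1, h2, h3, h4⟩ := contraction_support hd hf h
        exact hs (mem_flatsAvoiding.mpr ⟨faceSpan_mem_flats h1 h2, h3, h4⟩)
  rw [glue_apply, htotal]
  funext s
  by_cases hs : faceSpan w s ≤ L
  · rw [truncation_of_le hs, hhom s hs]
  · rw [truncation_of_not_le hs]
    by_contra h
    exact hs (hf.1 s (Ne.symm h)).2.le

theorem finrank_flatCocycles [FiniteDimensional ℝ V] {d : ℕ} {L : Submodule ℝ V}
    (hd : Module.finrank ℝ L = d + 1) {a : ι} (ha : w a ∈ L) :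
    Module.finrank F (flatCocycles F w L) =
      ∑ L' ∈ flatsAvoiding w d L a, Module.finrank F (flatCocycles F w L') := by
  have hrange : LinearMap.range (glue F w d L a) = flatCocycles F w L :=
    le_antisymm (by rintro _ ⟨g, rfl⟩; exact glue_mem hd a g) (flatCocycles_le_range_glue hd ha)
  rw [← hrange, LinearMap.finrank_range_of_inj (glue_injective ha), Module.finrank_pi_fintype]
  exact Finset.sum_coe_sort _ fun L' => Module.finrank F (flatCocycles F w L')

-- As no vector is zero, the only face inside `⊥` is the empty simplex.
omit [Fintype ι] in
theorem finrank_flatCocycles_bot (hw : ∀ i, w i ≠ 0) :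
    Module.finrank F (flatCocycles F w (⊥ : Submodule ℝ V)) = 1 := by
  have hmem : ∀ s : Finset ι, faceSpan w s ≤ ⊥ → s = ∅ := fun s hs =>
    Finset.eq_empty_of_forall_notMem fun i hi =>
      hw i ((Submodule.mem_bot ℝ).mp (faceSpan_le.mp hs i hi))
  have hsingle : (Pi.single ∅ 1 : Finset ι → F) ∈ flatCocycles F w (⊥ : Submodule ℝ V) := by
    refine ⟨fun s hs => ?_, fun s hs => by rw [hmem s hs, coboundary_apply, Finset.sum_empty]⟩
    obtain rfl : s = ∅ := by
      by_contra h
      exact hs (Pi.single_eq_of_ne h _)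
    simp [faceSpan]
  refine finrank_eq_one ⟨_, hsingle⟩ (fun h => ?_) fun f => ⟨f.1 ∅, ?_⟩
  · simpa using congr_fun (congr_arg Subtype.val h) ∅
  · ext s
    by_cases hs : s = ∅
    · simp [hs]
    · have : f.1 s = 0 := by
        by_contra h
        exact hs (hmem s (f.2.1 s h).2.le)
      simp [hs, this]

end

end VectorConfiguration

/-! ### Weighted counts of ordered bases. -/

namespace VectorConfiguration

open SimplicialHomology

noncomputable section

variable {ι V : Type*} [AddCommGroup V] [Module ℝ V] {w : ι → V}

theorem flagSpace_cons_of_le {d l : ℕ} (hl : l ≤ d) (i : ι) (W : Fin d → ι) :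
    flagSpace w (Fin.cons i W : Fin (d + 1) → ι) l = flagSpace w W l := by
  rw [flagSpace, flagSpace]
  congr 1
  ext x
  simp only [Set.mem_image, Set.mem_ofPred_eq, Fin.exists_fin_succ, Fin.cons_zero, Fin.cons_succ,
    Fin.val_zero, Fin.val_succ]
  constructor
  · rintro (⟨h, -⟩ | ⟨j, h, rfl⟩)
    · omega
    · exact ⟨j, by omega, rfl⟩
  · rintro ⟨j, h, rfl⟩
    exact Or.inr ⟨j, by omega, rfl⟩

theorem flagSpace_cons_self {d : ℕ} (i : ι) (W : Fin d → ι) :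
    flagSpace w (Fin.cons i W : Fin (d + 1) → ι) (d + 1) =
      Submodule.span ℝ {w i} ⊔ flagSpace w W d := by
  rw [flagSpace_self, flagSpace_self, ← Submodule.span_insert]
  congr 1
  ext x
  simp [Fin.exists_fin_succ, eq_comm]

variable [Fintype ι]

open Classical in
variable (w) in
/-- The (indices of the) vectors of `H` that lie in `L`. -/
def flatMembers (L : Submodule ℝ V) : Finset ι := Finset.univ.filter fun i => w i ∈ L

theorem mem_flatMembers {L : Submodule ℝ V} {i : ι} : i ∈ flatMembers w L ↔ w i ∈ L := by
  simp [flatMembers]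

theorem flagProduct_cons {d : ℕ} (i : ι) (W : Fin d → ι) :
    flagProduct w (Fin.cons i W : Fin (d + 1) → ι) =
      flagProduct w W *
        (flatMembers w (flagSpace w (Fin.cons i W : Fin (d + 1) → ι) (d + 1))).card := by
  rw [flagProduct, Finset.prod_Icc_succ_top (by omega), flagProduct]
  congr 1
  refine Finset.prod_congr rfl fun l hl => ?_
  rw [flagMembers, flagMembers, flagSpace_cons_of_le (Finset.mem_Icc.mp hl).2]

theorem cons_mem_independentTuples {d : ℕ} {i : ι} {W : Fin d → ι} :
    (Fin.cons i W : Fin (d + 1) → ι) ∈ independentTuples w (d + 1) ↔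
      W ∈ independentTuples w d ∧ w i ∉ flagSpace w W d := by
  rw [mem_independentTuples, mem_independentTuples, flagSpace_self, ← linearIndependent_finCons]
  have h : (fun j => w ((Fin.cons i W : Fin (d + 1) → ι) j)) =
      (Fin.cons (w i) fun j => w (W j) : Fin (d + 1) → V) :=
    funext fun j => Fin.cases rfl (fun _ => rfl) j
  rw [h]

/-- For a subspace `L` of dimension `d + 1`, the bases of `L` are obtained from the bases of its
hyperplanes by adding a further vector of `L`. -/
theorem cons_mem_independentTuples_and_flagSpace_eq [FiniteDimensional ℝ V] {d : ℕ}
    {L : Submodule ℝ V} (hd : Module.finrank ℝ L = d + 1) {i : ι} {W : Fin d → ι} :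
    ((Fin.cons i W : Fin (d + 1) → ι) ∈ independentTuples w (d + 1) ∧
        flagSpace w (Fin.cons i W : Fin (d + 1) → ι) (d + 1) = L) ↔
      i ∈ flatMembers w L ∧ W ∈ independentTuples w d ∧
        flagSpace w W d ≤ L ∧ w i ∉ flagSpace w W d := by
  rw [mem_flatMembers]
  constructor
  · rintro ⟨h, rfl⟩
    obtain ⟨hW, hi⟩ := cons_mem_independentTuples.mp h
    rw [flagSpace_cons_self]
    exact ⟨Submodule.mem_sup_left (Submodule.mem_span_singleton_self _), hW, le_sup_right, hi⟩
  · rintro ⟨hiL, hW, hle, hi⟩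
    have h := cons_mem_independentTuples.mpr ⟨hW, hi⟩
    refine ⟨h, Submodule.eq_of_le_of_finrank_eq ?_ ?_⟩
    · rw [flagSpace_cons_self, sup_le_iff]
      exact ⟨(Submodule.span_singleton_le_iff_mem _ _).mpr hiL, hle⟩
    · rw [finrank_flagSpace_self h, hd]

open Classical in
variable (w) in
/-- The sum of `1 / W[H]` over the ordered bases `W` of the flat `L` of rank `d`. -/
def flatWeight (d : ℕ) (L : Submodule ℝ V) : ℝ :=
  ∑ W ∈ (independentTuples w d).filter fun W => flagSpace w W d = L, (flagProduct w W : ℝ)⁻¹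

open Classical in
theorem sum_flatWeight_flatsAvoiding (d : ℕ) (L : Submodule ℝ V) (a : ι) :
    ∑ L' ∈ flatsAvoiding w d L a, flatWeight w d L' =
      ∑ W ∈ (independentTuples w d).filter fun W => flagSpace w W d ≤ L ∧ w a ∉ flagSpace w W d,
        (flagProduct w W : ℝ)⁻¹ := by
  rw [← Finset.sum_fiberwise_of_maps_to (t := flatsAvoiding w d L a)
    (g := fun W : Fin d → ι => flagSpace w W d)]
  · refine Finset.sum_congr rfl fun L' hL' => ?_
    rw [flatWeight, Finset.filter_filter]
    refine Finset.sum_congr (Finset.filter_congr fun W _ => ?_) fun _ _ => rfl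
    refine ⟨?_, And.right⟩
    rintro rfl
    exact ⟨(mem_flatsAvoiding.mp hL').2, rfl⟩
  · intro W hW
    rw [Finset.mem_filter] at hW
    exact mem_flatsAvoiding.mpr ⟨mem_flats.mpr ⟨W, hW.1, rfl⟩, hW.2⟩

/-- Split off the first vector `a` of an ordered basis of `L`: the tail is an ordered basis of a
hyperplane avoiding `w a`, and the new factor of `W[H]` is `|L ∩ H|`, the same for all bases. -/
theorem flatWeight_succ [FiniteDimensional ℝ V] {d : ℕ} {L : Submodule ℝ V}
    (hd : Module.finrank ℝ L = d + 1) :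
    flatWeight w (d + 1) L =
      ((flatMembers w L).card : ℝ)⁻¹ *
        ∑ a ∈ flatMembers w L, ∑ L' ∈ flatsAvoiding w d L a, flatWeight w d L' := by
  classical
  simp only [sum_flatWeight_flatsAvoiding]
  rw [Finset.mul_sum, flatWeight]
  simp only [Finset.mul_sum]
  rw [Finset.sum_sigma']
  symm
  refine Finset.sum_bij (fun x _ => (Fin.cons x.1 x.2 : Fin (d + 1) → ι)) ?_ ?_ ?_ ?_
  · rintro ⟨i, W⟩ h
    rw [Finset.mem_sigma, Finset.mem_filter] at h
    rw [Finset.mem_filter]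
    exact (cons_mem_independentTuples_and_flagSpace_eq hd).mpr h
  · rintro ⟨i, W⟩ _ ⟨i', W'⟩ _ h
    obtain ⟨rfl, rfl⟩ := Fin.cons_inj.mp h
    rfl
  · intro U hU
    rw [Finset.mem_filter, ← Fin.cons_self_tail U,
      cons_mem_independentTuples_and_flagSpace_eq hd] at hU
    refine ⟨⟨U 0, Fin.tail U⟩, ?_, Fin.cons_self_tail U⟩
    rw [Finset.mem_sigma, Finset.mem_filter]
    exact hU
  · rintro ⟨i, W⟩ h
    rw [Finset.mem_sigma, Finset.mem_filter] at h
    rw [flagProduct_cons, ((cons_mem_independentTuples_and_flagSpace_eq hd).mpr h).2]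
    push_cast
    rw [mul_inv_rev]

theorem flatWeight_zero : flatWeight w 0 (⊥ : Submodule ℝ V) = 1 := by
  classical
  have hW : ∀ W : Fin 0 → ι, W ∈ independentTuples w 0 ∧ flagSpace w W 0 = ⊥ := fun W =>
    ⟨mem_independentTuples.mpr linearIndependent_empty_type, by simp [flagSpace_self]⟩
  rw [flatWeight, Finset.filter_true_of_mem fun W _ => (hW W).2,
    Finset.eq_univ_of_forall fun W => (hW W).1]
  simp [flagProduct]

/-- By induction every inner sum in `flatWeight_succ` equals the dimension of `Z(L)`, whatever `a`
is, so their average does too. -/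
theorem finrank_flatCocycles_eq_flatWeight [LinearOrder ι] [FiniteDimensional ℝ V]
    (F : Type*) [Field F] (hw : ∀ i, w i ≠ 0) {d : ℕ} {L : Submodule ℝ V} (hL : L ∈ flats w d) :
    (Module.finrank F (flatCocycles F w L) : ℝ) = flatWeight w d L := by
  induction d generalizing L with
  | zero =>
    obtain rfl : L = ⊥ := Submodule.finrank_eq_zero.mp (finrank_of_mem_flats hL)
    rw [finrank_flatCocycles_bot hw, flatWeight_zero, Nat.cast_one]
  | succ d ih =>
    have hd := finrank_of_mem_flats hL
    have hcard : ((flatMembers w L).card : ℝ) ≠ 0 := by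
      obtain ⟨W, -, rfl⟩ := mem_flats.mp hL
      refine Nat.cast_ne_zero.mpr (Finset.card_ne_zero_of_mem (a := W 0) (mem_flatMembers.mpr ?_))
      rw [flagSpace_self]
      exact Submodule.subset_span ⟨0, rfl⟩
    have hsum : ∀ a ∈ flatMembers w L, ∑ L' ∈ flatsAvoiding w d L a, flatWeight w d L' =
        (Module.finrank F (flatCocycles F w L) : ℝ) := by
      intro a ha
      rw [finrank_flatCocycles hd (mem_flatMembers.mp ha), Nat.cast_sum]
      exact Finset.sum_congr rfl fun L' hL' => (ih (mem_flatsAvoiding.mp hL').1).symm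
    rw [flatWeight_succ hd, Finset.sum_congr rfl hsum, Finset.sum_const, nsmul_eq_mul,
      inv_mul_cancel_left₀ hcard]

/-! ### The formula for one vertex, and its weighted average. -/

open Classical in
theorem finrank_reducedHomology_eq_sum [LinearOrder ι] [FiniteDimensional ℝ V]
    (F : Type*) [Field F] (hw : ∀ i, w i ≠ 0) {n : ℕ} (hV : Module.finrank ℝ V = n + 1) (a : ι) :
    (Module.finrank F (ReducedHomology F (nonspanningComplex w) ((n : ℤ) - 1)) : ℝ) =
      ∑ W ∈ (independentTuples w n).filter fun W => a ∉ flagMembers w W n,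
        (flagProduct w W : ℝ)⁻¹ := by
  rw [finrank_reducedHomology a hV,
    finrank_flatCocycles (d := n) (by rw [finrank_top, hV]) (Submodule.mem_top (x := w a)),
    Nat.cast_sum, Finset.sum_congr rfl fun L' hL' =>
      finrank_flatCocycles_eq_flatWeight F hw (mem_flatsAvoiding.mp hL').1,
    sum_flatWeight_flatsAvoiding]
  refine Finset.sum_congr (Finset.filter_congr fun W _ => ?_) fun _ _ => rfl
  simp [flagMembers]

end

end VectorConfiguration

theorem theorem1 {n T : ℕ} (w : Fin T → EuclideanSpace ℝ (Fin (n + 1)))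
    (hw_inj : Function.Injective w) (hw_ne : ∀ i, w i ≠ 0)
    (hw_span : Submodule.span ℝ (Set.range w) = ⊤)
    (F : Type*) [Field F]
    (p : Fin T → ℝ) (hp : ∑ i, p i = 1) :
    (Module.finrank F (SimplicialHomology.ReducedHomology F
        (VectorConfiguration.nonspanningComplex w) ((n : ℤ) - 1)) : ℝ) =
      ∑ W ∈ VectorConfiguration.independentTuples w n,
        (1 - ∑ i ∈ VectorConfiguration.flagMembers w W n, p i) /
          (VectorConfiguration.flagProduct w W : ℝ) := by
  classical
  have hsum := VectorConfiguration.finrank_reducedHomology_eq_sum F hw_ne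
    (finrank_euclideanSpace_fin (𝕜 := ℝ) (n := n + 1))
  -- The rank is written as `∑ i, p i * rank`, with the formula for the vertex `i` used in the
  -- `i`-th summand; exchanging the sums leaves, for each `W`, the total weight of the indices
  -- outside `L_n(W)`.
  rw [← one_mul (Module.finrank F _ : ℝ), ← hp, Finset.sum_mul,
    Finset.sum_congr rfl fun i _ => by rw [hsum i, Finset.mul_sum, Finset.sum_filter],
    Finset.sum_comm]
  refine Finset.sum_congr rfl fun W _ => ?_
  rw [hp, ← Finset.sum_filter, ← Finset.sum_mul, div_eq_mul_inv, ← hp,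
    ← Finset.sum_add_sum_compl (VectorConfiguration.flagMembers w W n) p, add_sub_cancel_left]
  congr 2
  ext i
  simp
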